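/- Let $\mathsf P$ be the transition matrix of an irreducible Markov chain on a finite state space $V$ (nonnegative entries, row sums $1$, and for all $x,y\in V$ there is $t$ with $\mathsf P^t(x,y)>0$), and let $\pi$ be its stationary distribution ($\pi\mathsf P=\pi$). Write $\pi(A)=\sum_{x\in A}\pi(x)$ and $\mathsf Q(A,v)=\sum_{x\in A}\pi(x)\mathsf P(x,v)$ for $A\subseteq V$, $v\in V$, and $\|\sigma-\pi\|_{TV}=\frac12\sum_{x\in V}|\sigma(x)-\pi(x)|$. Let $f:[0,1]\to\mathbb R_{\ge 0}$. For $A\subseteq V$ put $$A_u=\{v\in V:\ \mathsf Q(A,v)\ge u\,\pi(v)\},\qquad \mathcal C_f(A)=\frac{\int_0^1 f(\pi(A_u))\,du}{f(\pi(A))}.$$ (A maximum over an empty family, which occurs below only if $|V|=1$, is read as $0$.) (i) Every complex eigenvalue $\lambda_i\neq1$ of $\mathsf P$ satisfies, for every integer $t\ge0$, $$\tfrac12|\lambda_i|^t\ \le\ \max_{x\in V}\|\mathsf P^t(x,\cdot)-\pi\|_{TV}.$$ (ii) Suppose $0<f(a)\le f(1-a)$ for all $a\in(0,1/2]$, and let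 $\mathcal C_f=\max_{0<\pi(A)\le1/2}\mathcal C_f(A)$. Then for every integer $t\ge0$ $$\max_{x\in V}\|\mathsf P^t(x,\cdot)-\pi\|_{TV}\ \le\ \Big(\max_{0<\pi(A)\le1/2}\frac{\pi(A)\,\pi(A^c)}{f(\pi(A))}\Big)\Big(\max_{x\in V}\frac{f(\pi(x))}{\pi(x)}\Big)\,\mathcal C_f^{\,t},$$ and every complex eigenvalue $\lambda_i\ne1$ of $\mathsf P$ satisfies $1-|\lambda_i|\ge1-\mathcal C_f$. (iii) Suppose only that $f(a)>0$ for all $a\in(0,1)$. Then both conclusions of (ii) hold with the maxima over $A$, in the definition of $\mathcal C_f$ and in the first factor, taken over all $A$ with $0<\pi(A)<1$ in place of $0<\pi(A)\le1/2$. -/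

import Mathlib

open scoped Matrix

noncomputable section

namespace EvolvingSet

variable {V : Type*} [Fintype V] [DecidableEq V]

/-- The mass `π(A)` of a set of states. -/
def mass (π : V → ℝ) (A : Finset V) : ℝ := ∑ x ∈ A, π x

/-- The ergodic flow `Q(A, B) = ∑_{x ∈ A, y ∈ B} π(x) P(x, y)`. -/
def flow (P : Matrix V V ℝ) (π : V → ℝ) (A B : Finset V) : ℝ :=
  ∑ x ∈ A, ∑ y ∈ B, π x * P x y

/-- The set `A_u = {v : Q(A, v) ≥ u π(v)}`. -/
def evolve (P : Matrix V V ℝ) (π : V → ℝ) (A : Finset V) (u : ℝ) : Finset V :=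
  {v : V | flow P π A {v} ≥ u * π v}

/-- The `f`-congestion of a set, `C_f(A) = (∫₀¹ f(π(A_u)) du) / f(π(A))`. The integrand is a step
function of `u`, so it is integrable whatever `f` is. -/
def setCongestion (P : Matrix V V ℝ) (π : V → ℝ) (f : ℝ → ℝ) (A : Finset V) : ℝ :=
  (∫ u in (0 : ℝ)..1, f (mass π (evolve P π A u))) / f (mass π A)

/-- The sets with `0 < π(A) ≤ 1/2`. -/
def smallSets (π : V → ℝ) : Set (Finset V) := {A | 0 < mass π A ∧ mass π A ≤ 1 / 2}

/-- The sets with `0 < π(A) < 1`. -/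
def properSets (π : V → ℝ) : Set (Finset V) := {A | 0 < mass π A ∧ mass π A < 1}

/-- The maximal `f`-congestion `C_f` over a family of sets. This is a maximum, because there are
finitely many sets (and it is `0` for the empty family, which occurs only for a single state). -/
def congestion (P : Matrix V V ℝ) (π : V → ℝ) (f : ℝ → ℝ) (𝓕 : Set (Finset V)) : ℝ :=
  ⨆ A : 𝓕, setCongestion P π f A

/-- The maximum of `π(A) π(Aᶜ) / f(π(A))` over a family of sets. -/
def maxSetRatio (π : V → ℝ) (f : ℝ → ℝ) (𝓕 : Set (Finset V)) : ℝ :=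
  ⨆ A : 𝓕, mass π (A : Finset V) * mass π (A : Finset V)ᶜ / f (mass π (A : Finset V))

/-- The maximum of `f(π(x)) / π(x)` over the states. -/
def maxStateRatio (π : V → ℝ) (f : ℝ → ℝ) : ℝ := ⨆ x : V, f (π x) / π x

/-- Total variation distance `½ ∑_x |σ(x) - π(x)|`. -/
def tvDist (σ π : V → ℝ) : ℝ := (1 / 2) * ∑ x, |σ x - π x|

/-- The worst-case distance `max_x ‖P^t(x, ·) - π‖_TV` after `t` steps. -/
def maxTV (P : Matrix V V ℝ) (π : V → ℝ) (t : ℕ) : ℝ := ⨆ x : V, tvDist ((P ^ t) x) π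

/-- `l` is a complex eigenvalue of the real matrix `P`. -/
def IsComplexEigenvalue (P : Matrix V V ℝ) (l : ℂ) : Prop :=
  Module.End.HasEigenvalue (Matrix.toLin' (P.map ((↑) : ℝ → ℂ))) l

end EvolvingSet

end

namespace EvolvingSet

open MeasureTheory

/-! ### Integrability along the process and orthogonality of eigenvectors to `π` -/

section Basic

variable {V : Type*} {P : Matrix V V ℝ} {π : V → ℝ}

/-! The proof runs the evolving set process: from `A` move to `A_u` with `u` uniform on `[0,1]`. A
state `y` lies in `A_u` with probability `Q(A,y)/π(y)`, so the operator `evolveOp` acts on the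
functions `A ↦ π(y)·1[y ∈ A]` through the matrix `P`, and `t` steps from `{x}` recover `π(x)
P^t(x,y)` (`evolveOp_pow_stateIndicator`).

Weighting by the signs of `P^t(x,y) - π(y)` writes `2 π(x)` times the distance as the expectation of
a function of the random set that is at most `2 π(S) π(Sᶜ)` (`signedDiscrepancy_le`). If `π(S) π(Sᶜ)
≤ M Φ(S)` and one step contracts `Φ` by `C`, monotonicity gives the distance bound `M (Φ{x}/π(x))
C^t` (`tvDist_le_of_evolveOp_le`). In (iii), `Φ` is `f(π(A))`, set to zero at `∅` and `V`; in (ii),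
`f(min(π(A), π(Aᶜ)))` with the same cutoff, whose symmetry reduces large sets to small ones
(`evolveOp_compl`).

For (i), a right eigenvector for `l ≠ 1` is orthogonal to `π`; applying `P^t - π` to it at a state
of maximal modulus gives the lower bound. Comparison with the geometric upper bound as `t → ∞` gives
`|l| ≤ C`. -/

lemma flow_singleton_right (P : Matrix V V ℝ) (π : V → ℝ) (A : Finset V) (v : V) :
    flow P π A {v} = ∑ x ∈ A, π x * P x v := by
  simp [flow]

lemma eq_empty_of_mass_nonpos (hpos : ∀ x, 0 < π x) {A : Finset V} (h : mass π A ≤ 0) :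
    A = ∅ := by
  by_contra hA
  exact absurd (Finset.sum_pos (fun x _ => hpos x) (Finset.nonempty_iff_ne_empty.2 hA)) h.not_gt

variable [Fintype V]

lemma mem_evolve {A : Finset V} {u : ℝ} {v : V} :
    v ∈ evolve P π A u ↔ u * π v ≤ flow P π A {v} := by
  simp [evolve]

lemma div_le_maxStateRatio (π : V → ℝ) (f : ℝ → ℝ) (x : V) :
    f (π x) / π x ≤ maxStateRatio π f :=
  le_ciSup (f := fun x => f (π x) / π x) (Set.finite_range _).bddAbove x

/-- `A_u` takes finitely many values, each on a measurable set of `u`, so the integrand is bounded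
and measurable for every `φ`. -/
lemma intervalIntegrable_comp_evolve (P : Matrix V V ℝ) (π : V → ℝ) (φ : Finset V → ℝ)
    (A : Finset V) (a b : ℝ) :
    IntervalIntegrable (fun u => φ (evolve P π A u)) volume a b := by
  let _ : MeasurableSpace (Finset V) := ⊤
  have hmeas : Measurable (evolve P π A) := by
    refine measurable_to_countable' fun B => ?_
    have : evolve P π A ⁻¹' {B} =
        ⋂ v, {u : ℝ | u * π v ≤ flow P π A {v} ↔ v ∈ B} := by
      ext u
      simp [Finset.ext_iff, mem_evolve]
    rw [this]
    refine MeasurableSet.iInter fun v => ?_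
    exact (measurableSet_le (measurable_id.mul_const _) measurable_const).iff
      (MeasurableSet.const _)
  have hφ : Measurable (fun u => φ (evolve P π A u)) := measurable_from_top.comp hmeas
  rw [intervalIntegrable_iff]
  refine Measure.integrableOn_of_bounded (M := ∑ B, |φ B|) (by simp) hφ.aestronglyMeasurable ?_
  refine Filter.Eventually.of_forall fun u => ?_
  exact Finset.single_le_sum (f := fun B => |φ B|) (fun B _ => abs_nonneg _) (Finset.mem_univ _)

/-- A right eigenvector for an eigenvalue other than `1` is orthogonal to a stationary vector. -/
lemma sum_stationary_mul_eigenvector (hstat : π ᵥ* P = π) {l : ℂ} (hl : l ≠ 1) {w : V → ℂ}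
    (hw : ∀ x, ∑ y, (P x y : ℂ) * w y = l * w x) : ∑ y, (π y : ℂ) * w y = 0 := by
  have h : ∑ y, (π y : ℂ) * w y = l * ∑ x, (π x : ℂ) * w x := by
    calc ∑ y, (π y : ℂ) * w y = ∑ y, ∑ x, (π x : ℂ) * P x y * w y := by
          refine Finset.sum_congr rfl fun y _ => ?_
          rw [← Finset.sum_mul, ← congrFun hstat y]
          simp [Matrix.vecMul, dotProduct]
      _ = ∑ x, (π x : ℂ) * ∑ y, (P x y : ℂ) * w y := by
          rw [Finset.sum_comm]
          simp only [mul_assoc, ← Finset.mul_sum]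
      _ = l * ∑ x, (π x : ℂ) * w x := by
          simp only [hw, Finset.mul_sum]
          exact Finset.sum_congr rfl fun z _ => by ring
  have h2 : (l - 1) * ∑ y, (π y : ℂ) * w y = 0 := by linear_combination -h
  exact (mul_eq_zero.1 h2).resolve_left (sub_ne_zero.2 hl)

end Basic

/-! ### Stationary mass and flow -/

section Mass

variable {V : Type*} [Fintype V] [DecidableEq V] {P : Matrix V V ℝ} {π : V → ℝ}

lemma mass_compl (hπ : π ∈ stdSimplex ℝ V) (A : Finset V) : mass π Aᶜ = 1 - mass π A := by
  rw [eq_sub_iff_add_eq, mass, mass, add_comm, Finset.sum_add_sum_compl, hπ.2]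

lemma mass_mem_Icc (hπ : π ∈ stdSimplex ℝ V) (A : Finset V) : mass π A ∈ Set.Icc (0 : ℝ) 1 := by
  have h : ∀ B : Finset V, 0 ≤ mass π B := fun B => Finset.sum_nonneg fun x _ => hπ.1 x
  have := h Aᶜ
  rw [mass_compl hπ] at this
  exact ⟨h A, by linarith⟩

lemma flow_nonneg (hP : P ∈ Matrix.rowStochastic ℝ V) (hπ : π ∈ stdSimplex ℝ V)
    (A B : Finset V) : 0 ≤ flow P π A B :=
  Finset.sum_nonneg fun x _ => Finset.sum_nonneg fun y _ => mul_nonneg (hπ.1 x) (hP.1 x y)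

lemma flow_compl (hstat : π ᵥ* P = π) (A : Finset V) (v : V) :
    flow P π Aᶜ {v} = π v - flow P π A {v} := by
  rw [eq_sub_iff_add_eq, flow_singleton_right, flow_singleton_right, add_comm,
    Finset.sum_add_sum_compl]
  exact congrFun hstat v

lemma vecMul_pow_eq (hstat : π ᵥ* P = π) (t : ℕ) : π ᵥ* P ^ t = π := by
  induction t with
  | zero => simp
  | succ t ih => rw [pow_succ, ← Matrix.vecMul_vecMul, ih, hstat]

/-- Some state has positive mass, and irreducibility carries it to `y` through `π = π P^t`. -/
lemma stationary_pos (hP : P ∈ Matrix.rowStochastic ℝ V)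
    (hirr : ∀ x y : V, ∃ t : ℕ, 0 < (P ^ t) x y) (hπ : π ∈ stdSimplex ℝ V)
    (hstat : π ᵥ* P = π) (y : V) : 0 < π y := by
  obtain ⟨x, -, hx⟩ : ∃ x ∈ Finset.univ, 0 < π x := by
    by_contra! h
    exact absurd (Finset.sum_nonpos h) (by rw [hπ.2]; norm_num)
  obtain ⟨t, ht⟩ := hirr x y
  rw [← congrFun (vecMul_pow_eq hstat t) y]
  exact Finset.sum_pos' (fun z _ => mul_nonneg (hπ.1 z) ((pow_mem hP t).1 z y))
    ⟨x, Finset.mem_univ x, mul_pos hx ht⟩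

end Mass

/-! ### Eigenvalues against distance to stationarity -/

section Eigenvalue

variable {V : Type*} [Fintype V] [DecidableEq V] {P : Matrix V V ℝ} {π : V → ℝ}

/-- A right eigenvector of `P` for `l` is a right eigenvector of `P ^ t` for `l ^ t`. -/
lemma pow_mulVec_eigenvector {l : ℂ} {w : V → ℂ}
    (hw : ∀ x, ∑ y, (P x y : ℂ) * w y = l * w x) (t : ℕ) (x : V) :
    ∑ y, ((P ^ t) x y : ℂ) * w y = l ^ t * w x := by
  induction t generalizing x with
  | zero => simp [Matrix.one_apply, apply_ite Complex.ofReal]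
  | succ t ih =>
    simp only [pow_succ', Matrix.mul_apply, Complex.ofReal_sum, Complex.ofReal_mul,
      Finset.sum_mul]
    rw [Finset.sum_comm]
    simp only [mul_assoc, ← Finset.mul_sum, ih]
    calc ∑ z, (P x z : ℂ) * (l ^ t * w z) = l ^ t * ∑ z, (P x z : ℂ) * w z := by
          rw [Finset.mul_sum]; exact Finset.sum_congr rfl fun z _ => by ring
      _ = l * (l ^ t * w x) := by rw [hw]; ring

lemma tvDist_le_maxTV (P : Matrix V V ℝ) (π : V → ℝ) (t : ℕ) (x : V) :
    tvDist ((P ^ t) x) π ≤ maxTV P π t :=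
  le_ciSup (f := fun x => tvDist ((P ^ t) x) π) (Set.finite_range _).bddAbove x

/-- The worst-case distance to stationarity is at least `½ |l| ^ t`. -/
lemma half_norm_pow_le_maxTV (hstat : π ᵥ* P = π) {l : ℂ} (hev : IsComplexEigenvalue P l)
    (hl : l ≠ 1) (t : ℕ) : (1 / 2) * ‖l‖ ^ t ≤ maxTV P π t := by
  obtain ⟨w, hw⟩ := Module.End.HasEigenvalue.exists_hasEigenvector hev
  have hP : ∀ x, ∑ y, (P x y : ℂ) * w y = l * w x := fun x => by
    simpa [Matrix.mulVec, dotProduct] using congrFun hw.apply_eq_smul x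
  obtain ⟨x₀, hx₀⟩ := Function.ne_iff.1 hw.2
  obtain ⟨x, -, hx⟩ := Finset.exists_max_image Finset.univ (fun y => ‖w y‖) ⟨x₀, Finset.mem_univ _⟩
  have hwx : 0 < ‖w x‖ := (norm_pos_iff.2 hx₀).trans_le (hx x₀ (Finset.mem_univ _))
  -- Subtracting `π` costs nothing, since `w` is orthogonal to it.
  have hsum : l ^ t * w x = ∑ y, (((P ^ t) x y - π y : ℝ) : ℂ) * w y := by
    simp only [Complex.ofReal_sub, sub_mul, Finset.sum_sub_distrib]
    rw [pow_mulVec_eigenvector hP, sum_stationary_mul_eigenvector hstat hl hP, sub_zero]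
  have hle : ‖l‖ ^ t * ‖w x‖ ≤ (∑ y, |(P ^ t) x y - π y|) * ‖w x‖ := by
    rw [← norm_pow, ← norm_mul, hsum, Finset.sum_mul]
    refine norm_sum_le_of_le _ fun y hy => ?_
    rw [norm_mul, Complex.norm_real, Real.norm_eq_abs]
    exact mul_le_mul_of_nonneg_left (hx y hy) (abs_nonneg _)
  refine le_trans ?_ (tvDist_le_maxTV P π t x)
  exact mul_le_mul_of_nonneg_left (le_of_mul_le_mul_right hle hwx) (by norm_num)

/-- Geometric decay of the worst-case distance bounds the moduli of the eigenvalues. -/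
lemma norm_eigenvalue_le (hstat : π ᵥ* P = π) {K C : ℝ} (hC : 0 ≤ C)
    (h : ∀ t, maxTV P π t ≤ K * C ^ t) {l : ℂ} (hev : IsComplexEigenvalue P l) (hl : l ≠ 1) :
    ‖l‖ ≤ C := by
  by_contra! hlt
  have hl0 : 0 < ‖l‖ := hC.trans_lt hlt
  -- If `C < ‖l‖`, then `1/2 ≤ K (C/‖l‖)^t` for all `t`, and the right side tends to `0`.
  have hlim : Filter.Tendsto (fun t : ℕ => K * (C / ‖l‖) ^ t) Filter.atTop (nhds (K * 0)) :=
    (tendsto_pow_atTop_nhds_zero_of_lt_one (by positivity) ((div_lt_one hl0).2 hlt)).const_mul K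
  have hge : (1 / 2 : ℝ) ≤ K * 0 := ge_of_tendsto' hlim fun t => by
    rw [div_pow, ← mul_div_assoc, le_div_iff₀ (pow_pos hl0 t)]
    exact (half_norm_pow_le_maxTV hstat hev hl t).trans (h t)
  norm_num at hge

end Eigenvalue

/-! ### The evolving set process and its duality with the chain -/

section Kernel

variable {V : Type*} [Fintype V] [DecidableEq V] {P : Matrix V V ℝ} {π : V → ℝ}

/-- The transition operator `φ ↦ (A ↦ ∫₀¹ φ(A_u) du)` of the evolving set process. -/
noncomputable def evolveOp (P : Matrix V V ℝ) (π : V → ℝ) : (Finset V → ℝ) →ₗ[ℝ] (Finset V → ℝ) where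
  toFun φ A := ∫ u in (0 : ℝ)..1, φ (evolve P π A u)
  map_add' φ ψ := funext fun A => intervalIntegral.integral_add
    (intervalIntegrable_comp_evolve P π φ A 0 1) (intervalIntegrable_comp_evolve P π ψ A 0 1)
  map_smul' c _ := funext fun _ => intervalIntegral.integral_const_mul c _

lemma evolveOp_apply (φ : Finset V → ℝ) (A : Finset V) :
    evolveOp P π φ A = ∫ u in (0 : ℝ)..1, φ (evolve P π A u) := rfl

lemma evolveOp_mono {φ ψ : Finset V → ℝ} (h : φ ≤ ψ) : evolveOp P π φ ≤ evolveOp P π ψ :=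
  fun A => intervalIntegral.integral_mono_on zero_le_one
    (intervalIntegrable_comp_evolve P π φ A 0 1) (intervalIntegrable_comp_evolve P π ψ A 0 1)
    fun _ _ => h _

lemma evolveOp_pow_mono {φ ψ : Finset V → ℝ} (h : φ ≤ ψ) (t : ℕ) :
    (evolveOp P π ^ t) φ ≤ (evolveOp P π ^ t) ψ := by
  induction t with
  | zero => simpa using h
  | succ t ih => simpa only [pow_succ', Module.End.mul_apply] using evolveOp_mono ih

lemma evolveOp_pow_le {Φ : Finset V → ℝ} {C : ℝ} (hC : 0 ≤ C) (h : evolveOp P π Φ ≤ C • Φ)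
    (t : ℕ) : (evolveOp P π ^ t) Φ ≤ C ^ t • Φ := by
  induction t with
  | zero => simp
  | succ t ih =>
    calc (evolveOp P π ^ (t + 1)) Φ = evolveOp P π ((evolveOp P π ^ t) Φ) := by
          rw [pow_succ', Module.End.mul_apply]
      _ ≤ evolveOp P π (C ^ t • Φ) := evolveOp_mono ih
      _ = C ^ t • evolveOp P π Φ := map_smul _ _ _
      _ ≤ C ^ t • (C • Φ) := smul_le_smul_of_nonneg_left h (pow_nonneg hC t)
      _ = C ^ (t + 1) • Φ := by rw [smul_smul, pow_succ]

lemma integral_ite_le_const {c : ℝ} (h0 : 0 ≤ c) (h1 : c ≤ 1) :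
    ∫ u in (0 : ℝ)..1, (if u ≤ c then (1 : ℝ) else 0) = c := by
  have hi : ∀ a b : ℝ, IntervalIntegrable (fun u : ℝ => if u ≤ c then (1 : ℝ) else 0) volume a b := by
    intro a b
    refine AntitoneOn.intervalIntegrable fun x _ y _ hxy => ?_
    split_ifs <;> linarith
  rw [← intervalIntegral.integral_add_adjacent_intervals (hi 0 c) (hi c 1)]
  have h₁ : ∫ u in (0 : ℝ)..c, (if u ≤ c then (1 : ℝ) else 0) = ∫ _ in (0 : ℝ)..c, (1 : ℝ) := by
    refine intervalIntegral.integral_congr fun u hu => ?_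
    rw [Set.uIcc_of_le h0] at hu
    exact if_pos hu.2
  have h₂ : ∫ u in c..1, (if u ≤ c then (1 : ℝ) else 0) = 0 := by
    refine intervalIntegral.integral_zero_ae (Filter.Eventually.of_forall fun u hu => ?_)
    rw [Set.uIoc_of_le h1] at hu
    exact if_neg hu.1.not_ge
  rw [h₁, h₂]
  simp

/-- The `π`-weighted indicator of the event that the set contains `y`. -/
def stateIndicator (π : V → ℝ) (y : V) (A : Finset V) : ℝ := if y ∈ A then π y else 0

lemma sum_stateIndicator (π : V → ℝ) (A : Finset V) : ∑ y, stateIndicator π y A = mass π A := by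
  simp [stateIndicator, mass]

/-- The `u` in `[0,1]` with `y ∈ A_u` form the interval from `0` to `Q(A,y)/π(y)`, which is at most
`1` by stationarity. -/
lemma evolveOp_stateIndicator (hP : P ∈ Matrix.rowStochastic ℝ V) (hπ : π ∈ stdSimplex ℝ V)
    (hstat : π ᵥ* P = π) (hpos : ∀ x, 0 < π x) (y : V) :
    evolveOp P π (stateIndicator π y) = ∑ x, P x y • stateIndicator π x := by
  funext A
  have hflow : flow P π A {y} ≤ π y := by
    have := flow_nonneg hP hπ Aᶜ {y}
    rw [flow_compl hstat] at this
    linarith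
  have h : ∀ u, stateIndicator π y (evolve P π A u) =
      π y * (if u ≤ flow P π A {y} / π y then (1 : ℝ) else 0) := fun u => by
    simp [stateIndicator, mem_evolve, le_div_iff₀ (hpos y)]
  simp only [evolveOp_apply, h]
  rw [intervalIntegral.integral_const_mul, integral_ite_le_const
    (div_nonneg (flow_nonneg hP hπ _ _) (hpos y).le) ((div_le_one (hpos y)).2 hflow),
    mul_div_cancel₀ _ (hpos y).ne', flow_singleton_right]
  simp [stateIndicator, mul_comm]

/-- Duality between the evolving set process and the chain:
`π(y) Pr_A(y ∈ S_t) = ∑_{x ∈ A} π(x) P^t(x, y)`. -/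
lemma evolveOp_pow_stateIndicator (hP : P ∈ Matrix.rowStochastic ℝ V) (hπ : π ∈ stdSimplex ℝ V)
    (hstat : π ᵥ* P = π) (hpos : ∀ x, 0 < π x) (t : ℕ) (y : V) :
    (evolveOp P π ^ t) (stateIndicator π y) = ∑ x, (P ^ t) x y • stateIndicator π x := by
  induction t with
  | zero => simp [Matrix.one_apply]
  | succ t ih =>
    rw [pow_succ', Module.End.mul_apply, ih, map_sum]
    simp only [map_smul, evolveOp_stateIndicator hP hπ hstat hpos, Finset.smul_sum, smul_smul]
    rw [Finset.sum_comm]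
    simp only [pow_succ', Matrix.mul_apply, Finset.sum_smul, mul_comm]

/-- A signed test function on sets whose `t`-step expectation from `{x}` is
`∑ y, s y * (P^t(x, y) - π y)` up to the factor `π x`. -/
def signedDiscrepancy (π : V → ℝ) (s : V → ℝ) : Finset V → ℝ :=
  ∑ y, s y • (stateIndicator π y - π y • ∑ z, stateIndicator π z)

/-- The states inside `A` contribute at most `π(A) π(Aᶜ)` in total, and so do those outside. -/
lemma signedDiscrepancy_le (hπ : π ∈ stdSimplex ℝ V) {s : V → ℝ} (hs : ∀ y, |s y| ≤ 1)
    (A : Finset V) : signedDiscrepancy π s A ≤ 2 * (mass π A * mass π Aᶜ) := by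
  have hA := mass_mem_Icc hπ A
  have hterm : ∀ y, s y * (stateIndicator π y A - π y * mass π A) ≤
      π y * (if y ∈ A then 1 - mass π A else mass π A) := by
    intro y
    have hy := hπ.1 y
    have hsy := abs_le.1 (hs y)
    unfold stateIndicator
    split_ifs
    · have := mul_le_mul_of_nonneg_right hsy.2 (mul_nonneg hy (sub_nonneg.2 hA.2))
      linarith
    · have := mul_le_mul_of_nonneg_right hsy.1 (mul_nonneg hy hA.1)
      linarith
  calc signedDiscrepancy π s A
      = ∑ y, s y * (stateIndicator π y A - π y * mass π A) := by
        simp [signedDiscrepancy, sum_stateIndicator]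
    _ ≤ ∑ y, π y * (if y ∈ A then 1 - mass π A else mass π A) :=
        Finset.sum_le_sum fun y _ => hterm y
    _ = mass π A * (1 - mass π A) + mass π Aᶜ * mass π A := by
        rw [← Finset.sum_add_sum_compl A]
        congr 1
        · rw [mass, Finset.sum_mul]
          exact Finset.sum_congr rfl fun y hy => by rw [if_pos hy]
        · rw [mass.eq_def π Aᶜ, Finset.sum_mul]
          exact Finset.sum_congr rfl fun y hy => by rw [if_neg (Finset.mem_compl.1 hy)]
    _ = 2 * (mass π A * mass π Aᶜ) := by rw [mass_compl hπ]; ring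

/-- Duality handles each indicator; as the rows of `P^t` sum to `1`, the expected mass of the set
stays `π(x)`, which produces the term `-π y`. -/
lemma evolveOp_pow_signedDiscrepancy (hP : P ∈ Matrix.rowStochastic ℝ V)
    (hπ : π ∈ stdSimplex ℝ V) (hstat : π ᵥ* P = π) (hpos : ∀ x, 0 < π x) (s : V → ℝ) (t : ℕ)
    (x : V) : (evolveOp P π ^ t) (signedDiscrepancy π s) {x} =
      π x * ∑ y, s y * ((P ^ t) x y - π y) := by
  have hrow : ∑ z, (P ^ t) x z = 1 := by
    simpa [Matrix.mulVec, dotProduct] using congrFun (pow_mem hP t).2 x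
  have hind : ∀ y, (∑ z, (P ^ t) z y • stateIndicator π z) {x} = (P ^ t) x y * π x := fun y => by
    simp [stateIndicator]
  simp only [signedDiscrepancy, map_sum, map_smul, map_sub,
    evolveOp_pow_stateIndicator hP hπ hstat hpos]
  rw [Finset.sum_apply, Finset.mul_sum]
  refine Finset.sum_congr rfl fun y _ => ?_
  rw [Pi.smul_apply, Pi.sub_apply, Pi.smul_apply, hind, Finset.sum_apply,
    Finset.sum_congr rfl fun z _ => hind z, ← Finset.sum_mul, hrow]
  simp only [smul_eq_mul]
  ring

/-- A test function contracted by the evolving set process controls the distance to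
stationarity. -/
lemma tvDist_le_of_evolveOp_le (hP : P ∈ Matrix.rowStochastic ℝ V) (hπ : π ∈ stdSimplex ℝ V)
    (hstat : π ᵥ* P = π) (hpos : ∀ x, 0 < π x) {Φ : Finset V → ℝ} {M C : ℝ} (hM : 0 ≤ M)
    (hC : 0 ≤ C) (hΦC : evolveOp P π Φ ≤ C • Φ) (hΦM : ∀ A, mass π A * mass π Aᶜ ≤ M * Φ A)
    (t : ℕ) (x : V) : tvDist ((P ^ t) x) π ≤ M * (Φ {x} / π x) * C ^ t := by
  -- These signs depend on `x` and `t`, but the bound on the discrepancy holds for all signs.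
  set s : V → ℝ := fun y => SignType.sign ((P ^ t) x y - π y) with hs_def
  have hs : ∀ y, |s y| ≤ 1 := fun y => by
    simp only [hs_def]
    rcases SignType.sign ((P ^ t) x y - π y) <;> simp
  have hle : signedDiscrepancy π s ≤ (2 * M) • Φ := fun A => by
    have h₁ := signedDiscrepancy_le hπ hs A
    have h₂ := hΦM A
    simp only [Pi.smul_apply, smul_eq_mul]
    linarith
  have h₁ := evolveOp_pow_mono (P := P) (π := π) hle t {x}
  have h₂ := evolveOp_pow_le hC hΦC t {x}
  rw [evolveOp_pow_signedDiscrepancy hP hπ hstat hpos, map_smul] at h₁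
  simp only [hs_def, sign_mul_self, Pi.smul_apply, smul_eq_mul] at h₁ h₂
  have h₃ := h₁.trans (mul_le_mul_of_nonneg_left h₂ (by linarith : 0 ≤ 2 * M))
  have h₄ : M * (Φ {x} / π x) * C ^ t = M * Φ {x} * C ^ t / π x := by ring
  rw [h₄, le_div_iff₀ (hpos x), tvDist]
  linarith

end Kernel

/-! ### Complement symmetry and the choice of test function -/

section Congestion

variable {V : Type*} [Fintype V] [DecidableEq V] {P : Matrix V V ℝ} {π : V → ℝ}

/-- For almost every `u`, the complement of `A_u` is `(Aᶜ)_{1-u}`. -/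
lemma evolveOp_compl (hstat : π ᵥ* P = π) (hpos : ∀ x, 0 < π x) {Φ : Finset V → ℝ}
    (hΦ : ∀ A, Φ Aᶜ = Φ A) (A : Finset V) : evolveOp P π Φ Aᶜ = evolveOp P π Φ A := by
  have hsub := intervalIntegral.integral_comp_sub_left (fun u => Φ (evolve P π A u)) (1 : ℝ)
    (a := 0) (b := 1)
  simp only [sub_self, sub_zero] at hsub
  rw [evolveOp_apply, evolveOp_apply, ← hsub]
  refine intervalIntegral.integral_congr_ae ?_
  -- The identity fails only at ties `Q(A,v) = (1-u) π(v)`, that is, for finitely many `u`.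
  have hfin : (Set.range fun v => 1 - flow P π A {v} / π v).Finite := Set.finite_range _
  filter_upwards [hfin.countable.ae_notMem volume] with u hu _
  rw [← hΦ (evolve P π A (1 - u))]
  congr 1
  ext v
  rw [Finset.mem_compl, mem_evolve, mem_evolve, flow_compl hstat, not_le]
  have hne : flow P π A {v} ≠ (1 - u) * π v := fun h => hu ⟨v, by
    simp only [h]
    rw [mul_div_cancel_right₀ _ (hpos v).ne']
    ring⟩
  constructor
  · intro h
    exact lt_of_le_of_ne (by linarith) hne
  · intro h
    linarith

lemma evolveOp_empty (hpos : ∀ x, 0 < π x) {Φ : Finset V → ℝ} (h : Φ ∅ = 0) :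
    evolveOp P π Φ ∅ = 0 := by
  refine intervalIntegral.integral_zero_ae (Filter.Eventually.of_forall fun u hu => ?_)
  rw [Set.uIoc_of_le zero_le_one] at hu
  have : evolve P π ∅ u = ∅ := by
    refine Finset.eq_empty_of_forall_notMem fun v hv => ?_
    rw [mem_evolve, flow_singleton_right, Finset.sum_empty] at hv
    exact absurd (mul_pos hu.1 (hpos v)) hv.not_gt
  rw [this, h]

lemma evolveOp_univ (hstat : π ᵥ* P = π) (hpos : ∀ x, 0 < π x) {Φ : Finset V → ℝ}
    (h : Φ Finset.univ = 0) : evolveOp P π Φ Finset.univ = 0 := by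
  refine intervalIntegral.integral_zero_ae (Filter.Eventually.of_forall fun u hu => ?_)
  rw [Set.uIoc_of_le zero_le_one] at hu
  have : evolve P π Finset.univ u = Finset.univ := by
    refine Finset.eq_univ_of_forall fun v => ?_
    have hflow : flow P π Finset.univ {v} = π v := by
      rw [flow_singleton_right]
      exact congrFun hstat v
    rw [mem_evolve, hflow]
    exact mul_le_of_le_one_left (hpos v).le hu.2
  rw [this, h]

lemma congestion_nonneg (hπ : π ∈ stdSimplex ℝ V) {f : ℝ → ℝ}
    (hf : ∀ a ∈ Set.Icc (0 : ℝ) 1, 0 ≤ f a) (𝓕 : Set (Finset V)) : 0 ≤ congestion P π f 𝓕 :=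
  Real.iSup_nonneg fun _ => div_nonneg
    (intervalIntegral.integral_nonneg zero_le_one fun _ _ => hf _ (mass_mem_Icc hπ _))
    (hf _ (mass_mem_Icc hπ _))

lemma maxSetRatio_nonneg (hπ : π ∈ stdSimplex ℝ V) {f : ℝ → ℝ}
    (hf : ∀ a ∈ Set.Icc (0 : ℝ) 1, 0 ≤ f a) (𝓕 : Set (Finset V)) : 0 ≤ maxSetRatio π f 𝓕 :=
  Real.iSup_nonneg fun _ => div_nonneg
    (mul_nonneg (mass_mem_Icc hπ _).1 (mass_mem_Icc hπ _).1) (hf _ (mass_mem_Icc hπ _))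

lemma integral_le_congestion_mul {f : ℝ → ℝ} {𝓕 : Set (Finset V)} {A : Finset V} (hA : A ∈ 𝓕)
    (hfA : 0 < f (mass π A)) : evolveOp P π (fun B => f (mass π B)) A ≤
      congestion P π f 𝓕 * f (mass π A) := by
  rw [← div_le_iff₀ hfA]
  exact le_ciSup (f := fun A : 𝓕 => setCongestion P π f A) (Set.finite_range _).bddAbove ⟨A, hA⟩

lemma mass_mul_mass_compl_le {f : ℝ → ℝ} {𝓕 : Set (Finset V)} {A : Finset V} (hA : A ∈ 𝓕)
    (hfA : 0 < f (mass π A)) :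
    mass π A * mass π Aᶜ ≤ maxSetRatio π f 𝓕 * f (mass π A) := by
  rw [← div_le_iff₀ hfA]
  exact le_ciSup (f := fun A : 𝓕 => mass π (A : Finset V) * mass π (A : Finset V)ᶜ /
    f (mass π (A : Finset V))) (Set.finite_range _).bddAbove ⟨A, hA⟩

/-- The distance bound, for a test function `Φ` that vanishes at the absorbing sets, is dominated
by `f`, and is controlled by the family `𝓕` elsewhere. -/
lemma maxTV_le_of_dominated (hP : P ∈ Matrix.rowStochastic ℝ V) (hπ : π ∈ stdSimplex ℝ V)
    (hstat : π ᵥ* P = π) (hpos : ∀ x, 0 < π x) {f : ℝ → ℝ}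
    (hf : ∀ a ∈ Set.Icc (0 : ℝ) 1, 0 ≤ f a) {𝓕 : Set (Finset V)} {Φ : Finset V → ℝ}
    (hempty : Φ ∅ = 0) (huniv : Φ Finset.univ = 0) (hΦf : ∀ A, Φ A ≤ f (mass π A))
    (hΦC : ∀ A, 0 < mass π A → mass π A < 1 → evolveOp P π Φ A ≤ congestion P π f 𝓕 * Φ A)
    (hΦM : ∀ A, 0 < mass π A → mass π A < 1 →
      mass π A * mass π Aᶜ ≤ maxSetRatio π f 𝓕 * Φ A) (t : ℕ) :
    maxTV P π t ≤ maxSetRatio π f 𝓕 * maxStateRatio π f * congestion P π f 𝓕 ^ t := by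
  have hM := maxSetRatio_nonneg hπ hf 𝓕
  have hC := congestion_nonneg (P := P) hπ hf 𝓕
  -- As `π` is positive, only `∅` and `V` escape the two hypotheses on `Φ`, and there both
  -- inequalities read `0 ≤ 0`.
  have htriv : ∀ A : Finset V, A = ∅ ∨ A = Finset.univ ∨ 0 < mass π A ∧ mass π A < 1 := by
    intro A
    by_cases h0 : 0 < mass π A
    · by_cases h1 : mass π A < 1
      · exact Or.inr (Or.inr ⟨h0, h1⟩)
      · refine Or.inr (Or.inl ?_)
        rw [← Finset.compl_eq_empty_iff]
        refine eq_empty_of_mass_nonpos hpos ?_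
        rw [mass_compl hπ]
        linarith
    · exact Or.inl (eq_empty_of_mass_nonpos hpos (not_lt.1 h0))
  have hΦC' : evolveOp P π Φ ≤ congestion P π f 𝓕 • Φ := by
    intro A
    rcases htriv A with rfl | rfl | h
    · simp [evolveOp_empty hpos hempty, hempty]
    · simp [evolveOp_univ hstat hpos huniv, huniv]
    · exact hΦC A h.1 h.2
  have hΦM' : ∀ A, mass π A * mass π Aᶜ ≤ maxSetRatio π f 𝓕 * Φ A := by
    intro A
    rcases htriv A with rfl | rfl | h
    · simp [hempty, mass]
    · simp [huniv, mass]
    · exact hΦM A h.1 h.2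
  have : Nonempty V := by
    by_contra h
    rw [not_nonempty_iff] at h
    simpa using hπ.2
  refine ciSup_le fun x => ?_
  refine (tvDist_le_of_evolveOp_le hP hπ hstat hpos hM hC hΦC' hΦM' t x).trans ?_
  refine mul_le_mul_of_nonneg_right (mul_le_mul_of_nonneg_left ?_ hM) (pow_nonneg hC t)
  refine le_trans ?_ (div_le_maxStateRatio π f x)
  have := hΦf {x}
  rw [mass, Finset.sum_singleton] at this
  exact div_le_div_of_nonneg_right this (hpos x).le

/-- The distance bound with maxima over all proper sets. -/
lemma maxTV_le_properSets (hP : P ∈ Matrix.rowStochastic ℝ V) (hπ : π ∈ stdSimplex ℝ V)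
    (hstat : π ᵥ* P = π) (hpos : ∀ x, 0 < π x) {f : ℝ → ℝ}
    (hf : ∀ a ∈ Set.Icc (0 : ℝ) 1, 0 ≤ f a) (hfpos : ∀ a ∈ Set.Ioo (0 : ℝ) 1, 0 < f a) (t : ℕ) :
    maxTV P π t ≤ maxSetRatio π f (properSets π) * maxStateRatio π f *
      congestion P π f (properSets π) ^ t := by
  have hΦf : ∀ A, (if 0 < mass π A ∧ mass π A < 1 then f (mass π A) else 0) ≤ f (mass π A) := by
    intro A
    split_ifs
    · exact le_rfl
    · exact hf _ (mass_mem_Icc hπ A)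
  refine maxTV_le_of_dominated hP hπ hstat hpos hf
    -- The cutoff is needed because `f 0` and `f 1` may be positive, while contraction by `C` is
    -- required at the absorbing sets too.
    (Φ := fun A => if 0 < mass π A ∧ mass π A < 1 then f (mass π A) else 0)
    (by simp [mass]) (by simp [mass, hπ.2]) hΦf (fun A h0 h1 => ?_) (fun A h0 h1 => ?_) t
  · refine (evolveOp_mono (P := P) (π := π) hΦf A).trans ?_
    simp only [if_pos (And.intro h0 h1)]
    exact integral_le_congestion_mul ⟨h0, h1⟩ (hfpos _ ⟨h0, h1⟩)
  · simp only [if_pos (And.intro h0 h1)]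
    exact mass_mul_mass_compl_le ⟨h0, h1⟩ (hfpos _ ⟨h0, h1⟩)

/-- The distance bound with maxima over the sets of mass at most one half. -/
lemma maxTV_le_smallSets (hP : P ∈ Matrix.rowStochastic ℝ V) (hπ : π ∈ stdSimplex ℝ V)
    (hstat : π ᵥ* P = π) (hpos : ∀ x, 0 < π x) {f : ℝ → ℝ}
    (hf : ∀ a ∈ Set.Icc (0 : ℝ) 1, 0 ≤ f a)
    (hfsymm : ∀ a ∈ Set.Ioc (0 : ℝ) (1 / 2), 0 < f a ∧ f a ≤ f (1 - a)) (t : ℕ) :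
    maxTV P π t ≤ maxSetRatio π f (smallSets π) * maxStateRatio π f *
      congestion P π f (smallSets π) ^ t := by
  set Φ : Finset V → ℝ := fun A =>
    if 0 < mass π A ∧ mass π A < 1 then f (min (mass π A) (mass π Aᶜ)) else 0 with hΦ
  -- For large `A` this is the hypothesis `f a ≤ f (1 - a)` with `a = π(Aᶜ)`.
  have hΦf : ∀ A, Φ A ≤ f (mass π A) := by
    intro A
    simp only [hΦ]
    split_ifs with h
    · rcases le_total (mass π A) (mass π Aᶜ) with hle | hle
      · rw [min_eq_left hle]
      · rw [min_eq_right hle]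
        rw [mass_compl hπ] at hle ⊢
        simpa using (hfsymm (1 - mass π A) ⟨by linarith, by linarith⟩).2
    · exact hf _ (mass_mem_Icc hπ A)
  have hΦcompl : ∀ A, Φ Aᶜ = Φ A := by
    intro A
    have hiff : (0 < mass π Aᶜ ∧ mass π Aᶜ < 1) ↔ (0 < mass π A ∧ mass π A < 1) := by
      rw [mass_compl hπ]
      constructor <;> rintro ⟨h0, h1⟩ <;> constructor <;> linarith
    simp only [hΦ, hiff, compl_compl, min_comm (mass π Aᶜ)]
  have hsmall : ∀ A ∈ smallSets π, Φ A = f (mass π A) ∧ 0 < f (mass π A) := by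
    rintro A ⟨h0, h1⟩
    have hle : mass π A ≤ mass π Aᶜ := by rw [mass_compl hπ]; linarith
    refine ⟨?_, (hfsymm _ ⟨h0, h1⟩).1⟩
    simp only [hΦ]
    rw [if_pos ⟨h0, by linarith⟩, min_eq_left hle]
  have hlarge : ∀ A, 0 < mass π A → mass π A < 1 → A ∉ smallSets π → Aᶜ ∈ smallSets π := by
    intro A h0 h1 hA
    have : 1 / 2 < mass π A := by
      by_contra h
      exact hA ⟨h0, not_lt.1 h⟩
    constructor <;> rw [mass_compl hπ] <;> linarith
  have hC : ∀ A ∈ smallSets π,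
      evolveOp P π Φ A ≤ congestion P π f (smallSets π) * Φ A := by
    intro A hA
    rw [(hsmall A hA).1]
    exact (evolveOp_mono (P := P) (π := π) hΦf A).trans
      (integral_le_congestion_mul hA (hsmall A hA).2)
  have hM : ∀ A ∈ smallSets π, mass π A * mass π Aᶜ ≤ maxSetRatio π f (smallSets π) * Φ A := by
    intro A hA
    rw [(hsmall A hA).1]
    exact mass_mul_mass_compl_le hA (hsmall A hA).2
  refine maxTV_le_of_dominated hP hπ hstat hpos hf (Φ := Φ)
    (by simp [hΦ, mass]) (by simp [hΦ, mass, hπ.2]) hΦf (fun A h0 h1 => ?_) (fun A h0 h1 => ?_) t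
  · by_cases hA : A ∈ smallSets π
    · exact hC A hA
    -- Both sides are invariant under complement, so the large set is replaced by its small
    -- complement.
    · rw [← evolveOp_compl hstat hpos hΦcompl, ← hΦcompl]
      exact hC _ (hlarge A h0 h1 hA)
  · by_cases hA : A ∈ smallSets π
    · exact hM A hA
    · have := hM _ (hlarge A h0 h1 hA)
      rwa [compl_compl, hΦcompl, mul_comm] at this

end Congestion

end EvolvingSet

theorem theorem1 {V : Type*} [Fintype V] [DecidableEq V]
    (P : Matrix V V ℝ) (π : V → ℝ)
    (hP : P ∈ Matrix.rowStochastic ℝ V)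
    (hirr : ∀ x y : V, ∃ t : ℕ, 0 < (P ^ t) x y)
    (hπ : π ∈ stdSimplex ℝ V)
    (hstat : π ᵥ* P = π)
    (f : ℝ → ℝ) (hf : ∀ a ∈ Set.Icc (0 : ℝ) 1, 0 ≤ f a) :
    (∀ l : ℂ, EvolvingSet.IsComplexEigenvalue P l → l ≠ 1 →
      ∀ t : ℕ, (1 / 2) * ‖l‖ ^ t ≤ EvolvingSet.maxTV P π t) ∧
    ((∀ a ∈ Set.Ioc (0 : ℝ) (1 / 2), 0 < f a ∧ f a ≤ f (1 - a)) →
      (∀ t : ℕ, EvolvingSet.maxTV P π t ≤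
        EvolvingSet.maxSetRatio π f (EvolvingSet.smallSets π) *
          EvolvingSet.maxStateRatio π f *
          EvolvingSet.congestion P π f (EvolvingSet.smallSets π) ^ t) ∧
      (∀ l : ℂ, EvolvingSet.IsComplexEigenvalue P l → l ≠ 1 →
        1 - ‖l‖ ≥ 1 - EvolvingSet.congestion P π f (EvolvingSet.smallSets π))) ∧
    ((∀ a ∈ Set.Ioo (0 : ℝ) 1, 0 < f a) →
      (∀ t : ℕ, EvolvingSet.maxTV P π t ≤
        EvolvingSet.maxSetRatio π f (EvolvingSet.properSets π) *
          EvolvingSet.maxStateRatio π f *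
          EvolvingSet.congestion P π f (EvolvingSet.properSets π) ^ t) ∧
      (∀ l : ℂ, EvolvingSet.IsComplexEigenvalue P l → l ≠ 1 →
        1 - ‖l‖ ≥ 1 - EvolvingSet.congestion P π f (EvolvingSet.properSets π))) := by
  have hpos := EvolvingSet.stationary_pos hP hirr hπ hstat
  refine ⟨fun l hev hl t => EvolvingSet.half_norm_pow_le_maxTV hstat hev hl t, fun hfsymm => ?_,
    fun hfpos => ?_⟩
  · have h := EvolvingSet.maxTV_le_smallSets hP hπ hstat hpos hf hfsymm
    exact ⟨h, fun l hev hl => sub_le_sub_left (EvolvingSet.norm_eigenvalue_le hstat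
      (EvolvingSet.congestion_nonneg hπ hf _) h hev hl) 1⟩
  · have h := EvolvingSet.maxTV_le_properSets hP hπ hstat hpos hf hfpos
    exact ⟨h, fun l hev hl => sub_le_sub_left (EvolvingSet.norm_eigenvalue_le hstat
      (EvolvingSet.congestion_nonneg hπ hf _) h hev hl) 1⟩
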